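/- Let $X$ be a geodesic metric space, i.e. for all $x,y\in X$ there is an isometric embedding $\xi:[0,d(x,y)]\to X$ with $\xi(0)=x$ and $\xi(d(x,y))=y$. Suppose that: (a) $\operatorname{asdim} X=1$. Here $\operatorname{asdim}X\le n$ means that for every uniformly bounded open cover $\mathcal V$ of $X$ there is a uniformly bounded open cover $\mathcal U$ of $X$ of multiplicity at most $n+1$ such that every $V\in\mathcal V$ is contained in some $U\in\mathcal U$; and $\operatorname{asdim}X=n$ means that $\operatorname{asdim}X\le n$ but not $\operatorname{asdim}X\le n-1$. (b) The fundamental group of $X$ is uniformly generated: there is $L>0$ such that, for every base point $x_0\in X$, the group $\pi_1(X,x_0)$ is generated by the classes of the loops $p f\bar p$, where $f$ is a loop in $X$ of length at most $L$ and $p$ is a path from $x_0$ to $f(0)=f(1)$. Then $X$ is quasi-isometric to an infinite tree. That is, there are a tree $T$ (a connected graph without cycles, not necessarily locally finite) with infinitely many vertices, constants $K\ge 1$, $C\ge 0$, and a map $f:X\to |T|$ to the geometric realization of $T$, equipped with the length metric in which every edge has length one, such that $$K^{-1}d(x,x')-C\le d(f(x),f(x'))\le K\,d(x,x')+C\quad\text{for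 all }x,x'\in X,$$ and every point of $|T|$ is at distance at most $C$ from $f(X)$. -/

import Mathlib

open Set

universe u

noncomputable section

namespace CoarseTree

/-! ### Geodesic spaces, asymptotic dimension, quasi-isometries -/

/-- `X` is geodesic: any two points `x`, `y` are joined by an isometric embedding of the interval
`[0, dist x y]`. -/
def IsGeodesicSpace (X : Type u) [MetricSpace X] : Prop :=
  ∀ x y : X, ∃ ξ : ℝ → X, ξ 0 = x ∧ ξ (dist x y) = y ∧
    ∀ s ∈ Icc (0 : ℝ) (dist x y), ∀ t ∈ Icc (0 : ℝ) (dist x y), dist (ξ s) (ξ t) = |s - t|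

/-- `𝒰` is a uniformly bounded open cover of `X`. -/
structure IsUniformlyBoundedOpenCover {X : Type u} [MetricSpace X] (𝒰 : Set (Set X)) : Prop where
  isOpen : ∀ U ∈ 𝒰, IsOpen U
  covers : ⋃₀ 𝒰 = univ
  bounded : ∃ D : ℝ, ∀ U ∈ 𝒰, ∀ x ∈ U, ∀ y ∈ U, dist x y ≤ D

/-- Every point of `X` lies in at most `m` members of `𝒰`. -/
def MultiplicityLE {X : Type u} (𝒰 : Set (Set X)) (m : ℤ) : Prop :=
  ∀ x : X, {U ∈ 𝒰 | x ∈ U}.Finite ∧ ({U ∈ 𝒰 | x ∈ U}.ncard : ℤ) ≤ m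

/-- `𝒱` refines `𝒰`. -/
def Refines {X : Type u} (𝒱 𝒰 : Set (Set X)) : Prop :=
  ∀ V ∈ 𝒱, ∃ U ∈ 𝒰, V ⊆ U

/-- `asdim X ≤ n`: every uniformly bounded open cover refines a uniformly bounded open cover of
multiplicity at most `n + 1`. -/
def AsdimLE (X : Type u) [MetricSpace X] (n : ℤ) : Prop :=
  ∀ 𝒱 : Set (Set X), IsUniformlyBoundedOpenCover 𝒱 →
    ∃ 𝒰 : Set (Set X), IsUniformlyBoundedOpenCover 𝒰 ∧ MultiplicityLE 𝒰 (n + 1) ∧ Refines 𝒱 𝒰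

/-- `asdim X = n`. -/
def AsdimEq (X : Type u) [MetricSpace X] (n : ℤ) : Prop :=
  AsdimLE X n ∧ ¬ AsdimLE X (n - 1)

/-- `f` is a quasi-isometry: a quasi-isometric embedding with coarsely dense image. -/
def IsQuasiIsometry {X Y : Type u} [MetricSpace X] [MetricSpace Y] (f : X → Y) : Prop :=
  ∃ K C : ℝ, 1 ≤ K ∧ 0 ≤ C ∧
    (∀ x x' : X, K⁻¹ * dist x x' - C ≤ dist (f x) (f x') ∧
      dist (f x) (f x') ≤ K * dist x x' + C) ∧
    ∀ y : Y, ∃ x : X, dist y (f x) ≤ C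

/-- `X` and `Y` are quasi-isometric. -/
def QuasiIsometric (X Y : Type u) [MetricSpace X] [MetricSpace Y] : Prop :=
  ∃ f : X → Y, IsQuasiIsometry f

/-! ### Uniformly generated fundamental groups -/

/-- The length of a path in a metric space. -/
def pathLength {X : Type u} [MetricSpace X] {x y : X} (γ : Path x y) : ENNReal :=
  eVariationOn γ univ

/-- The elements of `π₁(X, x₀)` of the form `[p f p̄]`, where `f` is a free loop of length at most
`L` and `p` is a path from `x₀` to the base point of `f`. -/
def shortLoopClasses (X : Type u) [MetricSpace X] (x₀ : X) (L : ℝ) : Set (FundamentalGroup X x₀) :=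
  {g | ∃ (y : X) (p : Path x₀ y) (f : Path y y), pathLength f ≤ ENNReal.ofReal L ∧
    g = FundamentalGroup.fromPath (Path.Homotopic.Quotient.mk ((p.trans f).trans p.symm))}

/-- The fundamental group of `X` is uniformly generated: for some `L > 0` it is generated by free
loops of length at most `L`. -/
def UniformlyGeneratedPi1 (X : Type u) [MetricSpace X] : Prop :=
  ∃ L : ℝ, 0 < L ∧ ∀ x₀ : X, Subgroup.closure (shortLoopClasses X x₀ L) = ⊤

/-! ### The geometric realization of a connected graph, all edges having length one -/

variable {V : Type u}

/-- The point at parameter `s ∈ [0, 1]` on the segment from the vertex `a` to the vertex `b`, in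
barycentric coordinates. -/
def edgePoint (a b : V) (s : ℝ) : V →₀ ℝ :=
  Finsupp.single a (1 - s) + Finsupp.single b s

/-- `EdgeChain G p q ℓ`: there is a finite chain of points from `p` to `q` of total length `ℓ`,
consecutive points lying on a common edge, and each edge being parametrized by `[0, 1]`. -/
inductive EdgeChain (G : SimpleGraph V) : (V →₀ ℝ) → (V →₀ ℝ) → ℝ → Prop
  | refl (p : V →₀ ℝ) : EdgeChain G p p 0
  | step {a b : V} {s t ℓ : ℝ} {q : V →₀ ℝ} (hab : G.Adj a b)
      (hs : s ∈ Icc (0 : ℝ) 1) (ht : t ∈ Icc (0 : ℝ) 1)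
      (h : EdgeChain G (edgePoint a b t) q ℓ) : EdgeChain G (edgePoint a b s) q (|s - t| + ℓ)

/-- The geometric realization of a connected graph: the union of its vertices and edges, as formal
convex combinations of vertices. It carries the length metric below. -/
@[ext]
structure Realization (G : SimpleGraph V) (hG : G.Connected) : Type u where
  val : V →₀ ℝ
  mem : (∃ v : V, val = Finsupp.single v 1) ∨
    ∃ a b : V, G.Adj a b ∧ ∃ s ∈ Icc (0 : ℝ) 1, val = edgePoint a b s

theorem edgePoint_zero (a b : V) : edgePoint a b 0 = Finsupp.single a 1 := by
  simp [edgePoint]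

theorem edgePoint_one (a b : V) : edgePoint a b 1 = Finsupp.single b 1 := by
  simp [edgePoint]

theorem EdgeChain.nonneg {G : SimpleGraph V} {p q : V →₀ ℝ} {ℓ : ℝ} (h : EdgeChain G p q ℓ) :
    0 ≤ ℓ := by
  induction h with
  | refl p => exact le_rfl
  | step _ _ _ _ ih => positivity

theorem EdgeChain.trans {G : SimpleGraph V} {p q r : V →₀ ℝ} {ℓ m : ℝ} (h : EdgeChain G p q ℓ)
    (h' : EdgeChain G q r m) : EdgeChain G p r (ℓ + m) := by
  induction h with
  | refl p => simpa using h'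
  | step hab hs ht _ ih =>
    rw [add_assoc]
    exact EdgeChain.step hab hs ht (ih h')

theorem EdgeChain.symm {G : SimpleGraph V} {p q : V →₀ ℝ} {ℓ : ℝ} (h : EdgeChain G p q ℓ) :
    EdgeChain G q p ℓ := by
  induction h with
  | refl p => exact EdgeChain.refl p
  | @step a b s t ℓ q hab hs ht _ ih =>
    have h1 : EdgeChain G (edgePoint a b t) (edgePoint a b s) (|t - s| + 0) :=
      EdgeChain.step hab ht hs (EdgeChain.refl _)
    have h2 := ih.trans h1
    rwa [add_zero, abs_sub_comm, add_comm] at h2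

theorem EdgeChain.abs_sub_le {G : SimpleGraph V} {p q : V →₀ ℝ} {ℓ : ℝ} (h : EdgeChain G p q ℓ)
    (v : V) : |p v - q v| ≤ ℓ := by
  classical
  induction h with
  | refl p => simp
  | @step a b s t ℓ q hab hs ht _ ih =>
    have h1 : |edgePoint a b s v - edgePoint a b t v| ≤ |s - t| := by
      have hne := hab.ne
      by_cases ha : a = v
      · have hb : b ≠ v := fun hb => hne (ha.trans hb.symm)
        simp [edgePoint, ha, hb, abs_sub_comm s t]
      · by_cases hb : b = v <;> simp [edgePoint, ha, hb]
    exact (_root_.abs_sub_le _ _ _).trans (add_le_add h1 ih)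

theorem EdgeChain.exists_of_walk {G : SimpleGraph V} {a b : V} (w : G.Walk a b) :
    ∃ ℓ, EdgeChain G (Finsupp.single a 1) (Finsupp.single b 1) ℓ := by
  induction w with
  | nil => exact ⟨0, EdgeChain.refl _⟩
  | @cons a b c hab _ ih =>
    obtain ⟨ℓ, hℓ⟩ := ih
    rw [← edgePoint_one a b] at hℓ
    rw [← edgePoint_zero a b]
    exact ⟨_, EdgeChain.step hab (by simp) (by simp) hℓ⟩

namespace Realization

variable {G : SimpleGraph V} {hG : G.Connected}

theorem exists_chain_vertex (p : Realization G hG) :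
    ∃ (v : V) (ℓ : ℝ), EdgeChain G p.val (Finsupp.single v 1) ℓ := by
  obtain ⟨p, ⟨v, rfl⟩ | ⟨a, b, hab, s, hs, rfl⟩⟩ := p
  · exact ⟨v, 0, EdgeChain.refl _⟩
  · refine ⟨a, |s - 0| + 0, EdgeChain.step hab hs (by simp) ?_⟩
    rw [edgePoint_zero]
    exact EdgeChain.refl _

theorem exists_chain (p q : Realization G hG) : ∃ ℓ : ℝ, EdgeChain G p.val q.val ℓ := by
  obtain ⟨v, ℓ, h⟩ := exists_chain_vertex p
  obtain ⟨w, m, h'⟩ := exists_chain_vertex q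
  obtain ⟨γ⟩ := hG.preconnected v w
  obtain ⟨k, hk⟩ := EdgeChain.exists_of_walk γ
  exact ⟨_, (h.trans hk).trans h'.symm⟩

theorem chain_bddBelow (p q : V →₀ ℝ) : BddBelow {ℓ : ℝ | EdgeChain G p q ℓ} :=
  ⟨0, fun _ h => EdgeChain.nonneg h⟩

/-- The length metric: the infimum of the lengths of the chains between two points. -/
instance : MetricSpace (Realization G hG) where
  dist p q := sInf {ℓ : ℝ | EdgeChain G p.val q.val ℓ}
  dist_self p := le_antisymm (csInf_le (chain_bddBelow _ _) (EdgeChain.refl p.val))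
    (Real.sInf_nonneg fun _ h => EdgeChain.nonneg h)
  dist_comm p q := congrArg sInf (Set.ext fun _ => ⟨EdgeChain.symm, EdgeChain.symm⟩)
  dist_triangle p q r := by
    refine le_of_forall_pos_le_add fun ε hε => ?_
    obtain ⟨ℓ, hℓ, h1⟩ := exists_lt_of_csInf_lt (exists_chain p q)
      (lt_add_of_pos_right (sInf {ℓ : ℝ | EdgeChain G p.val q.val ℓ}) (half_pos hε))
    obtain ⟨m, hm, h2⟩ := exists_lt_of_csInf_lt (exists_chain q r)
      (lt_add_of_pos_right (sInf {ℓ : ℝ | EdgeChain G q.val r.val ℓ}) (half_pos hε))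
    have h3 := csInf_le (chain_bddBelow p.val r.val) (EdgeChain.trans hℓ hm)
    linarith
  eq_of_dist_eq_zero {p q} h := by
    refine Realization.ext (Finsupp.ext fun v => ?_)
    have h1 : |p.val v - q.val v| ≤ sInf {ℓ : ℝ | EdgeChain G p.val q.val ℓ} :=
      le_csInf (exists_chain p q) fun _ hℓ => EdgeChain.abs_sub_le hℓ v
    exact sub_eq_zero.1 (abs_nonpos_iff.1 (h1.trans h.le))

end Realization

end CoarseTree

end

namespace CoarseTree

open scoped unitInterval Topology

/-! ### Geodesic spaces -/

section Geodesic

variable {X : Type u} [MetricSpace X]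

/-! The tree is the nerve of a cover of `X` at a scale `R > L`. Asymptotic dimension at most one
yields a uniformly bounded cover by path connected open sets, no three distinct ones sharing a
point, with every `R`-ball inside a member (`AsdimLE.exists_isPathConnectedCover`). Cutting
geodesics into short steps turns distances into walk lengths, so `X` is quasi-isometric to the nerve
(`IsPathConnectedCover.quasiIsometric`), which is infinite because `X` is unbounded.

The nerve has no cycle because each edge `A B` is a bridge (`IsPathConnectedCover.nerve_isAcyclic`).
Map `X` to the circle by winding once across `A ∩ B` and sending everything else to `0`. A loop of
length at most `L` stays in one member, where this map lifts to `ℝ`; such loops generate the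
fundamental group, so the map lifts globally (`exists_real_lift`). Off `A ∩ B` the lift is constant
on each member, and these constants can change only across the edge `A B`, where they differ by `1`.
Hence no other walk joins `A` to `B`. -/

theorem IsGeodesicSpace.isPathConnected_ball (hgeo : IsGeodesicSpace X) (x : X) {r : ℝ}
    (hr : 0 < r) : IsPathConnected (Metric.ball x r) := by
  refine ⟨x, Metric.mem_ball_self hr, fun {y} hy => ?_⟩
  obtain ⟨ξ, h0, h1, hξ⟩ := hgeo x y
  have hd : 0 ≤ dist x y := dist_nonneg
  have hmem : ∀ t ∈ I, t * dist x y ∈ Icc (0 : ℝ) (dist x y) := fun t ht =>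
    ⟨mul_nonneg ht.1 hd, mul_le_of_le_one_left hd ht.2⟩
  refine JoinedIn.ofLine (f := fun t => ξ (t * dist x y)) ?_ (by simp [h0]) (by simp [h1]) ?_
  · have hcont : ContinuousOn ξ (Icc 0 (dist x y)) := by
      refine LipschitzOnWith.continuousOn (K := 1) (LipschitzOnWith.of_dist_le_mul ?_)
      intro s hs t ht
      simp [hξ s hs t ht, Real.dist_eq]
    exact hcont.comp (by fun_prop) hmem
  · rintro _ ⟨t, ht, rfl⟩
    have := hξ _ (hmem t ht) 0 ⟨le_rfl, hd⟩
    rw [h0, sub_zero, abs_of_nonneg (hmem t ht).1] at this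
    rw [Metric.mem_ball, this]
    rw [Metric.mem_ball, dist_comm] at hy
    exact (hmem t ht).2.trans_lt hy

theorem IsGeodesicSpace.locallyPathConnectedSpace (hgeo : IsGeodesicSpace X) :
    LocallyPathConnectedSpace X :=
  .of_bases (fun _ => Metric.nhds_basis_ball) fun x _ hr => hgeo.isPathConnected_ball x hr

theorem IsGeodesicSpace.pathConnectedSpace [Nonempty X] (hgeo : IsGeodesicSpace X) :
    PathConnectedSpace X := by
  refine ⟨‹_›, fun x y => ?_⟩
  have h : 0 < dist y x + 1 := by positivity
  exact ((hgeo.isPathConnected_ball x h).joinedIn x (Metric.mem_ball_self h) y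
    (by simp)).joined

/-- Two points of a geodesic space are joined by a chain of `n + 1` steps of equal size. -/
theorem IsGeodesicSpace.exists_chain (hgeo : IsGeodesicSpace X) (x y : X) (n : ℕ) :
    ∃ z : ℕ → X, z 0 = x ∧ z (n + 1) = y ∧
      ∀ i ≤ n, dist (z i) (z (i + 1)) = dist x y / (n + 1) := by
  obtain ⟨ξ, h0, h1, hξ⟩ := hgeo x y
  have hn : (0 : ℝ) < n + 1 := by positivity
  have hmem : ∀ i : ℕ, i ≤ n + 1 → i * (dist x y / (n + 1)) ∈ Icc (0 : ℝ) (dist x y) := by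
    intro i hi
    have hi' : (i : ℝ) ≤ n + 1 := by exact_mod_cast hi
    refine ⟨by positivity, ?_⟩
    calc (i : ℝ) * (dist x y / (n + 1)) ≤ (n + 1) * (dist x y / (n + 1)) := by gcongr
      _ = dist x y := by field_simp
  refine ⟨fun i => ξ (i * (dist x y / (n + 1))), by simp [h0], ?_, fun i hi => ?_⟩
  · have : ((n + 1 : ℕ) : ℝ) * (dist x y / (n + 1)) = dist x y := by push_cast; field_simp
    simp only [this, h1]
  · dsimp only
    rw [hξ _ (hmem i (by omega)) _ (hmem (i + 1) (by omega)), ← sub_mul, abs_mul,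
      abs_of_nonneg (a := dist x y / (n + 1)) (by positivity)]
    simp

end Geodesic

/-! ### Covers of multiplicity two by path connected open sets -/

section Cover

/-- The nerve of a family of sets, as a graph. -/
def nerve {X : Type u} (𝒲 : Set (Set X)) : SimpleGraph 𝒲 where
  Adj A B := A ≠ B ∧ (A.1 ∩ B.1).Nonempty
  symm := ⟨fun A B h => ⟨h.1.symm, inter_comm A.1 B.1 ▸ h.2⟩⟩
  loopless := ⟨fun _ h => h.1 rfl⟩

theorem exists_walk_length_le_one_of_mem {X : Type u} {𝒲 : Set (Set X)} {A B : 𝒲}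
    {x : X} (hA : x ∈ A.1) (hB : x ∈ B.1) :
    ∃ w : (nerve 𝒲).Walk A B, w.length ≤ 1 := by
  by_cases h : A = B
  · subst h
    exact ⟨.nil, by simp⟩
  · have hAB : (nerve 𝒲).Adj A B := ⟨h, x, hA, hB⟩
    exact ⟨hAB.toWalk, by simp⟩

theorem MultiplicityLE.eq_or_eq {X : Type u} {𝒰 : Set (Set X)} (h : MultiplicityLE 𝒰 2)
    {A B W : Set X} (hA : A ∈ 𝒰) (hB : B ∈ 𝒰) (hW : W ∈ 𝒰) {x : X} (hxA : x ∈ A) (hxB : x ∈ B)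
    (hxW : x ∈ W) : A = B ∨ A = W ∨ B = W := by
  by_contra! hne
  obtain ⟨hfin, hcard⟩ := h x
  have hsub : ({A, B, W} : Set (Set X)) ⊆ {U ∈ 𝒰 | x ∈ U} := by
    rintro U (rfl | rfl | rfl) <;> exact ⟨‹_›, ‹_›⟩
  have h3 : ({A, B, W} : Set (Set X)).ncard = 3 :=
    Set.ncard_eq_three.2 ⟨A, B, W, hne.1, hne.2.1, hne.2.2, rfl⟩
  have := Set.ncard_le_ncard hsub hfin
  omega

variable {X : Type u} [MetricSpace X]

/-- A cover by path connected open sets of diameter at most `D`, of multiplicity at most two and of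
Lebesgue number at least `R`. -/
structure IsPathConnectedCover (𝒲 : Set (Set X)) (R D : ℝ) : Prop where
  isOpen : ∀ W ∈ 𝒲, IsOpen W
  isPathConnected : ∀ W ∈ 𝒲, IsPathConnected W
  eq_or_eq : ∀ A ∈ 𝒲, ∀ B ∈ 𝒲, ∀ W ∈ 𝒲, ∀ x ∈ A, x ∈ B → x ∈ W → A = B ∨ A = W ∨ B = W
  exists_ball_subset : ∀ x, ∃ W ∈ 𝒲, Metric.ball x R ⊆ W
  dist_le : ∀ W ∈ 𝒲, ∀ x ∈ W, ∀ y ∈ W, dist x y ≤ D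

/-- Path components of the members keep the multiplicity bound, since distinct components of one set
are disjoint. They still contain the balls, which are path connected in a geodesic space. -/
theorem AsdimLE.exists_isPathConnectedCover (hgeo : IsGeodesicSpace X) (hdim : AsdimLE X 1)
    {R : ℝ} (hR : 0 < R) : ∃ (𝒲 : Set (Set X)) (D : ℝ), IsPathConnectedCover 𝒲 R D := by
  have := hgeo.locallyPathConnectedSpace
  obtain ⟨𝒰, h𝒰, hmult, href⟩ := hdim (range fun x => Metric.ball x R)
    { isOpen := by rintro _ ⟨x, rfl⟩; exact Metric.isOpen_ball
      covers := eq_univ_of_forall fun x => ⟨_, ⟨x, rfl⟩, Metric.mem_ball_self hR⟩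
      bounded := by
        refine ⟨R + R, ?_⟩
        rintro _ ⟨x, rfl⟩ y hy z hz
        exact (dist_triangle_right y z x).trans
          (add_le_add (Metric.mem_ball.1 hy).le (Metric.mem_ball.1 hz).le) }
  obtain ⟨D, hD⟩ := h𝒰.bounded
  refine ⟨{W | ∃ U ∈ 𝒰, ∃ x ∈ U, W = pathComponentIn U x}, D, ?_, ?_, ?_, ?_, ?_⟩
  · rintro _ ⟨U, hU, x, -, rfl⟩
    exact (h𝒰.isOpen U hU).pathComponentIn x
  · rintro _ ⟨U, -, x, hx, rfl⟩
    exact isPathConnected_pathComponentIn hx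
  · rintro _ ⟨U₁, hU₁, x₁, -, rfl⟩ _ ⟨U₂, hU₂, x₂, -, rfl⟩ _ ⟨U₃, hU₃, x₃, -, rfl⟩ y h₁ h₂ h₃
    -- With all three components based at the common point `y`, equality of the ambient sets gives
    -- equality of the components.
    rw [← pathComponentIn_congr h₁, ← pathComponentIn_congr h₂, ← pathComponentIn_congr h₃]
    rcases MultiplicityLE.eq_or_eq hmult hU₁ hU₂ hU₃ (pathComponentIn_subset h₁)
      (pathComponentIn_subset h₂) (pathComponentIn_subset h₃) with rfl | rfl | rfl <;> simp
  · intro x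
    obtain ⟨U, hU, hsub⟩ := href _ ⟨x, rfl⟩
    have hx := Metric.mem_ball_self (x := x) hR
    exact ⟨_, ⟨U, hU, x, hsub hx, rfl⟩,
      (hgeo.isPathConnected_ball x hR).subset_pathComponentIn hx hsub⟩
  · rintro _ ⟨U, hU, x, -, rfl⟩ y hy z hz
    exact hD U hU y (pathComponentIn_subset hy) z (pathComponentIn_subset hz)

theorem asdimLE_zero_of_dist_le {D : ℝ} (h : ∀ x y : X, dist x y ≤ D) : AsdimLE X 0 := by
  intro 𝒱 _
  refine ⟨{univ}, ⟨by simp, by simp, D, by simpa using h⟩, fun x => ?_, fun V _ => ⟨univ, by simp⟩⟩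
  have : {U ∈ ({univ} : Set (Set X)) | x ∈ U} = {univ} := by ext U; aesop
  rw [this]
  simp

/-- Needed because `Metric.infDist` to the empty set is `0`: the edge function degenerates unless
the complements of `A` and `B` are nonempty. -/
theorem exists_notMem_of_not_asdimLE_zero (hX : ¬ AsdimLE X 0) {W : Set X} {D : ℝ}
    (hW : ∀ x ∈ W, ∀ y ∈ W, dist x y ≤ D) : Wᶜ.Nonempty := by
  by_contra h
  rw [not_nonempty_iff_eq_empty, compl_empty_iff] at h
  exact hX (asdimLE_zero_of_dist_le fun x y => hW x (h ▸ mem_univ x) y (h ▸ mem_univ y))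

variable {𝒲 : Set (Set X)} {R D : ℝ}

/-- The walk runs through `A`, one member for each of the `n + 1` steps of the chain, and `B`, hence
the bound `n + 2`. -/
theorem IsPathConnectedCover.exists_walk_length_le (h𝒲 : IsPathConnectedCover 𝒲 R D)
    (z : ℕ → X) (n : ℕ) (hz : ∀ i ≤ n, dist (z i) (z (i + 1)) < R) {A B : 𝒲}
    (hA : z 0 ∈ A.1) (hB : z (n + 1) ∈ B.1) :
    ∃ w : (nerve 𝒲).Walk A B, w.length ≤ n + 2 := by
  have hball : ∀ i ≤ n, ∃ W : 𝒲, z i ∈ W.1 ∧ z (i + 1) ∈ W.1 := by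
    intro i hi
    obtain ⟨W, hW, hsub⟩ := h𝒲.exists_ball_subset (z i)
    have := hz i hi
    exact ⟨⟨W, hW⟩, hsub (Metric.mem_ball_self (dist_nonneg.trans_lt this)),
      hsub (by rwa [Metric.mem_ball, dist_comm])⟩
  induction n generalizing B with
  | zero =>
    obtain ⟨W, h0, h1⟩ := hball 0 le_rfl
    obtain ⟨w, hw⟩ := exists_walk_length_le_one_of_mem hA h0
    obtain ⟨w', hw'⟩ := exists_walk_length_le_one_of_mem h1 hB
    exact ⟨w.append w', by simp; omega⟩
  | succ n ih =>
    obtain ⟨W, h0, h1⟩ := hball (n + 1) le_rfl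
    obtain ⟨w, hw⟩ := ih (fun i hi => hz i (by omega)) h0 (fun i hi => hball i (by omega))
    obtain ⟨w', hw'⟩ := exists_walk_length_le_one_of_mem h1 hB
    exact ⟨w.append w', by simp; omega⟩

/-- Points of a geodesic space at distance `d` lie in members of the cover at distance at most
`d / R + 2` in the nerve. -/
theorem IsPathConnectedCover.exists_walk (hgeo : IsGeodesicSpace X)
    (h𝒲 : IsPathConnectedCover 𝒲 R D) (hR : 0 < R) {x y : X} {A B : 𝒲} (hA : x ∈ A.1)
    (hB : y ∈ B.1) : ∃ w : (nerve 𝒲).Walk A B, (w.length : ℝ) ≤ R⁻¹ * dist x y + 2 := by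
  set n := ⌊R⁻¹ * dist x y⌋₊
  obtain ⟨z, h0, h1, hz⟩ := hgeo.exists_chain x y n
  have hn : (n : ℝ) ≤ R⁻¹ * dist x y := Nat.floor_le (by positivity)
  have hn' : R⁻¹ * dist x y < n + 1 := Nat.lt_floor_add_one _
  have hlt : dist x y / (n + 1) < R := by
    rw [div_lt_iff₀ (by positivity)]
    rwa [inv_mul_lt_iff₀ hR] at hn'
  obtain ⟨w, hw⟩ := h𝒲.exists_walk_length_le z n (fun i hi => (hz i hi).trans_lt hlt)
    (h0 ▸ hA) (h1 ▸ hB)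
  have hw' : (w.length : ℝ) ≤ n + 2 := by exact_mod_cast hw
  exact ⟨w, hw'.trans (by linarith)⟩

theorem IsPathConnectedCover.exists_mem (h𝒲 : IsPathConnectedCover 𝒲 R D) (hR : 0 < R) (x : X) :
    ∃ W : 𝒲, x ∈ W.1 := by
  obtain ⟨W, hW, hsub⟩ := h𝒲.exists_ball_subset x
  exact ⟨⟨W, hW⟩, hsub (Metric.mem_ball_self hR)⟩

theorem IsPathConnectedCover.nerve_connected [Nonempty X] (hgeo : IsGeodesicSpace X)
    (h𝒲 : IsPathConnectedCover 𝒲 R D) (hR : 0 < R) : (nerve 𝒲).Connected := by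
  have : Nonempty 𝒲 := ⟨(h𝒲.exists_mem hR (Classical.arbitrary X)).choose⟩
  refine ⟨fun A B => ?_⟩
  obtain ⟨x, hx⟩ := (h𝒲.isPathConnected A.1 A.2).nonempty
  obtain ⟨y, hy⟩ := (h𝒲.isPathConnected B.1 B.2).nonempty
  exact ⟨(h𝒲.exists_walk hgeo hR hx hy).choose⟩

theorem IsPathConnectedCover.dist_le_of_walk (h𝒲 : IsPathConnectedCover 𝒲 R D) {A B : 𝒲}
    (w : (nerve 𝒲).Walk A B) {x y : X} (hx : x ∈ A.1) (hy : y ∈ B.1) :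
    dist x y ≤ (w.length + 1) * D := by
  induction w generalizing x with
  | nil => simpa using h𝒲.dist_le _ (Subtype.prop _) x hx y hy
  | @cons A B' B hAB w ih =>
    obtain ⟨z, hzA, hzB⟩ := hAB.2
    have h1 := h𝒲.dist_le _ A.2 x hx z hzA
    have h2 := ih hzB hy
    have h3 := dist_triangle x z y
    rw [SimpleGraph.Walk.length_cons]
    push_cast
    linarith

theorem IsPathConnectedCover.infinite (h𝒲 : IsPathConnectedCover 𝒲 R D) (hR : 0 < R)
    (hX : ¬ AsdimLE X 0) : Infinite 𝒲 := by
  by_contra hfin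
  rw [not_infinite_iff_finite] at hfin
  refine hX ?_
  have hb : Bornology.IsBounded (⋃₀ 𝒲) := by
    rw [Bornology.isBounded_sUnion hfin]
    exact fun W hW => Metric.isBounded_iff.2 ⟨D, fun x hx y hy => h𝒲.dist_le W hW x hx y hy⟩
  obtain ⟨C, hC⟩ := Metric.isBounded_iff.1 hb
  have hmem : ∀ x, x ∈ ⋃₀ 𝒲 := fun x =>
    let ⟨W, hW⟩ := h𝒲.exists_mem hR x
    ⟨W.1, W.2, hW⟩
  exact asdimLE_zero_of_dist_le fun x y => hC (hmem x) (hmem y)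

end Cover

/-! ### Distances in the geometric realization -/

section Realization

variable {V : Type u} {G : SimpleGraph V}

theorem EdgeChain.of_walk {a b : V} (w : G.Walk a b) :
    EdgeChain G (Finsupp.single a 1) (Finsupp.single b 1) w.length := by
  induction w with
  | nil => simpa using EdgeChain.refl _
  | @cons a b c hab w ih =>
    rw [← edgePoint_one a b] at ih
    rw [← edgePoint_zero a b]
    have := EdgeChain.step hab (s := 0) (by simp) (by simp) ih
    rw [SimpleGraph.Walk.length_cons]
    push_cast
    simpa [add_comm] using this

/-- The affine extension of the graph distance from the vertex `a`. -/
noncomputable def distPotential (G : SimpleGraph V) (a : V) (p : V →₀ ℝ) : ℝ :=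
  p.sum fun v r => r * G.dist a v

theorem distPotential_single (a v : V) :
    distPotential G a (Finsupp.single v 1) = G.dist a v := by
  simp [distPotential]

theorem distPotential_edgePoint (a b c : V) (s : ℝ) :
    distPotential G a (edgePoint b c s) = (1 - s) * G.dist a b + s * G.dist a c := by
  rw [distPotential, edgePoint, Finsupp.sum_add_index' (by simp) (by intros; ring),
    Finsupp.sum_single_index (by simp), Finsupp.sum_single_index (by simp)]

/-- The potential is affine on each edge with slope in `[-1, 1]`, so it bounds chain lengths from
below. -/
theorem EdgeChain.distPotential_le (hG : G.Connected) (a : V) {p q : V →₀ ℝ} {ℓ : ℝ}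
    (h : EdgeChain G p q ℓ) : |distPotential G a p - distPotential G a q| ≤ ℓ := by
  induction h with
  | refl p => simp
  | @step b c s t ℓ q hbc _ _ _ ih =>
    refine (_root_.abs_sub_le _ (distPotential G a (edgePoint b c t)) _).trans (add_le_add ?_ ih)
    have h1 : (G.dist a b : ℝ) ≤ G.dist a c + 1 := by
      have := hG.dist_triangle (u := a) (v := c) (w := b)
      rw [SimpleGraph.dist_eq_one_iff_adj.2 hbc.symm] at this
      exact_mod_cast this
    have h2 : (G.dist a c : ℝ) ≤ G.dist a b + 1 := by
      have := hG.dist_triangle (u := a) (v := b) (w := c)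
      rw [SimpleGraph.dist_eq_one_iff_adj.2 hbc] at this
      exact_mod_cast this
    rw [distPotential_edgePoint, distPotential_edgePoint,
      show (1 - s) * (G.dist a b : ℝ) + s * G.dist a c - ((1 - t) * G.dist a b + t * G.dist a c)
        = (s - t) * (G.dist a c - G.dist a b) by ring, abs_mul]
    exact mul_le_of_le_one_right (abs_nonneg _) (abs_le.2 ⟨by linarith, by linarith⟩)

namespace Realization

variable {hG : G.Connected}

/-- A vertex, as a point of the geometric realization. -/
noncomputable def vertex (hG : G.Connected) (v : V) : Realization G hG :=
  ⟨Finsupp.single v 1, .inl ⟨v, rfl⟩⟩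

theorem dist_le_of_chain {p q : Realization G hG} {ℓ : ℝ} (h : EdgeChain G p.val q.val ℓ) :
    dist p q ≤ ℓ :=
  csInf_le (chain_bddBelow p.val q.val) h

theorem dist_vertex_le {a b : V} (w : G.Walk a b) :
    dist (vertex hG a) (vertex hG b) ≤ w.length :=
  dist_le_of_chain (EdgeChain.of_walk w)

theorem le_dist_vertex (a b : V) : (G.dist a b : ℝ) ≤ dist (vertex hG a) (vertex hG b) := by
  refine le_csInf (exists_chain _ _) fun ℓ hℓ => ?_
  have h := EdgeChain.distPotential_le hG a hℓ
  simp only [vertex, distPotential_single] at h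
  simpa using h

theorem exists_dist_vertex_le (p : Realization G hG) : ∃ v : V, dist p (vertex hG v) ≤ 1 := by
  obtain ⟨_, ⟨v, rfl⟩ | ⟨a, b, hab, s, hs, rfl⟩⟩ := p
  · exact ⟨v, (dist_self (vertex hG v)).trans_le zero_le_one⟩
  · refine ⟨a, (dist_le_of_chain (ℓ := |s - 0| + 0) ?_).trans ?_⟩
    · refine EdgeChain.step hab hs (by simp) ?_
      rw [edgePoint_zero]
      exact EdgeChain.refl _
    · simpa [abs_of_nonneg hs.1] using hs.2

end Realization

end Realization

/-! ### A space is quasi-isometric to the nerve of a cover -/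

theorem IsPathConnectedCover.quasiIsometric {X : Type u} [MetricSpace X] {𝒲 : Set (Set X)}
    {R D : ℝ} (hgeo : IsGeodesicSpace X) (h𝒲 : IsPathConnectedCover 𝒲 R D) (hR : 0 < R)
    (hG : (nerve 𝒲).Connected) : QuasiIsometric X (Realization (nerve 𝒲) hG) := by
  choose φ hφ using h𝒲.exists_mem hR
  set K : ℝ := max 1 (max D R⁻¹)
  have hK : 1 ≤ K := le_max_left _ _
  have hDK : D ≤ K := (le_max_left _ _).trans (le_max_right _ _)
  have hRK : R⁻¹ ≤ K := (le_max_right _ _).trans (le_max_right _ _)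
  have hK0 : 0 < K := zero_lt_one.trans_le hK
  -- The additive constant `2` is the one in `exists_walk`. It also covers density: at most `1` to a
  -- vertex `W`, then at most `1` to a chosen member meeting `W`.
  refine ⟨fun x => Realization.vertex hG (φ x), K, 2, hK, zero_le_two, fun x y => ⟨?_, ?_⟩,
    fun p => ?_⟩
  · obtain ⟨w, hw⟩ := hG.exists_walk_length_eq_dist (φ x) (φ y)
    have h1 := h𝒲.dist_le_of_walk w (hφ x) (hφ y)
    have h2 : (w.length : ℝ) ≤ dist (Realization.vertex hG (φ x)) (Realization.vertex hG (φ y)) :=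
      hw ▸ Realization.le_dist_vertex _ _
    have h3 : dist x y ≤ K * (w.length + 1) := by
      rw [mul_comm]
      exact h1.trans (by gcongr)
    rw [← inv_mul_le_iff₀ hK0] at h3
    linarith
  · obtain ⟨w, hw⟩ := h𝒲.exists_walk hgeo hR (hφ x) (hφ y)
    refine (Realization.dist_vertex_le w).trans (hw.trans ?_)
    gcongr
  · obtain ⟨W, hW⟩ := Realization.exists_dist_vertex_le p
    obtain ⟨x, hx⟩ := (h𝒲.isPathConnected W.1 W.2).nonempty
    obtain ⟨w, hw⟩ := exists_walk_length_le_one_of_mem hx (hφ x)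
    have h1 : (w.length : ℝ) ≤ 1 := by exact_mod_cast hw
    have h2 := Realization.dist_vertex_le (hG := hG) w
    have h3 := dist_triangle p (Realization.vertex hG W) (Realization.vertex hG (φ x))
    exact ⟨x, by linarith⟩

/-! ### Lifting circle-valued maps that are trivial on short loops -/

/-- A loop whose image in the circle lifts to a loop in `ℝ` has trivial class in the circle. -/
theorem mk_map_eq_refl_of_lift {X : Type u} [TopologicalSpace X] (φ : C(X, AddCircle (1 : ℝ)))
    {y : X} (f : Path y y) (g : C(I, ℝ)) (hg : g 0 = g 1)
    (hgφ : ∀ t, (g t : AddCircle (1 : ℝ)) = φ (f t)) :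
    Path.Homotopic.Quotient.mk (f.map φ.continuous) = Path.Homotopic.Quotient.refl (φ y) := by
  have h0 : φ y = (g 0 : AddCircle (1 : ℝ)) := by simp [hgφ]
  let γ : Path (g 0) (g 0) := ⟨g, rfl, hg.symm⟩
  let π : C(ℝ, AddCircle (1 : ℝ)) := ⟨_, (AddCircle.isCoveringMap_coe (1 : ℝ)).continuous⟩
  have h1 : (γ.map π.continuous).Homotopic ((Path.refl (g 0)).map π.continuous) :=
    (SimplyConnectedSpace.paths_homotopic γ (Path.refl (g 0))).map π
  have h2 := h1.pathCast h0 h0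
  have h3 : (γ.map π.continuous).cast h0 h0 = f.map φ.continuous := by
    ext t
    exact hgφ t
  have h4 : ((Path.refl (g 0)).map π.continuous).cast h0 h0 = Path.refl (φ y) := by
    ext t
    exact h0.symm
  rw [h3, h4] at h2
  rw [← Path.Homotopic.Quotient.mk_refl]
  exact Path.Homotopic.Quotient.eq.2 h2

/-- If short loops generate the fundamental group, then a map to the circle lifts to `ℝ` as soon as
it does so along every short loop. -/
theorem exists_real_lift {X : Type u} [MetricSpace X] [PathConnectedSpace X]
    [LocallyPathConnectedSpace X] (φ : C(X, AddCircle (1 : ℝ))) {L : ℝ} {x₀ : X}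
    (hgen : Subgroup.closure (shortLoopClasses X x₀ L) = ⊤)
    (hφ : ∀ (y : X) (f : Path y y), pathLength f ≤ ENNReal.ofReal L →
      ∃ g : C(I, ℝ), g 0 = g 1 ∧ ∀ t, (g t : AddCircle (1 : ℝ)) = φ (f t)) :
    ∃ g : C(X, ℝ), ∀ x, (g x : AddCircle (1 : ℝ)) = φ x := by
  obtain ⟨e, he⟩ := QuotientAddGroup.mk_surjective (φ x₀)
  -- Each generator is a conjugate of a short loop whose image is trivial. The trivial image then
  -- meets the lifting criterion for the covering of the circle by `ℝ`.
  have hker : (FundamentalGroup.map φ x₀).ker = ⊤ := by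
    rw [eq_top_iff, ← hgen, Subgroup.closure_le]
    rintro _ ⟨y, p, f, hf, rfl⟩
    obtain ⟨g, hg, hgφ⟩ := hφ y f hf
    have h := mk_map_eq_refl_of_lift φ f g hg hgφ
    rw [SetLike.mem_coe, MonoidHom.mem_ker, FundamentalGroup.one_def, FundamentalGroup.map_apply,
      ← Path.Homotopic.Quotient.mk_map, Path.map_trans, Path.map_trans, ← Path.map_symm,
      Path.Homotopic.Quotient.mk_trans, Path.Homotopic.Quotient.mk_trans, h,
      Path.Homotopic.Quotient.mk_symm]
    simp
  obtain ⟨g, ⟨-, hg⟩, -⟩ :=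
    (AddCircle.isCoveringMap_coe (1 : ℝ)).existsUnique_continuousMap_lifts_of_range_le
      (f := φ) (a₀ := x₀) (e₀ := e) he (by
        rintro _ ⟨γ, rfl⟩
        have : γ ∈ (FundamentalGroup.map φ x₀).ker := hker ▸ Subgroup.mem_top γ
        rw [MonoidHom.mem_ker.1 this]
        exact one_mem _)
  exact ⟨g, fun x => congrFun hg x⟩

/-! ### The circle-valued map of an edge of the nerve -/

section Edge

variable {X : Type u} [MetricSpace X] {A B : Set X}

/-- The function equal to `1` on `A \ B` and to `0` off `A`, which interpolates on `A ∩ B`. -/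
noncomputable def edgeFunction (A B : Set X) (x : X) : ℝ :=
  Metric.infDist x Aᶜ / (Metric.infDist x Aᶜ + Metric.infDist x Bᶜ)

theorem infDist_compl_pos (hA : IsOpen A) (hA' : Aᶜ.Nonempty) {x : X} (hx : x ∈ A) :
    0 < Metric.infDist x Aᶜ :=
  (hA.isClosed_compl.notMem_iff_infDist_pos hA').1 (not_not.2 hx)

theorem edgeFunction_eq_one (hA : IsOpen A) (hA' : Aᶜ.Nonempty) {x : X} (hxA : x ∈ A)
    (hxB : x ∉ B) : edgeFunction A B x = 1 := by
  rw [edgeFunction, Metric.infDist_zero_of_mem (s := Bᶜ) hxB, add_zero,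
    div_self (infDist_compl_pos hA hA' hxA).ne']

/-- Off `A ∪ B` the quotient is `0 / 0`, whose conventional value `0` is the one wanted. -/
theorem edgeFunction_eq_zero {x : X} (hxA : x ∉ A) : edgeFunction A B x = 0 := by
  rw [edgeFunction, Metric.infDist_zero_of_mem (s := Aᶜ) hxA, zero_div]

theorem continuousOn_edgeFunction (hA : IsOpen A) (hA' : Aᶜ.Nonempty) (hB : IsOpen B)
    (hB' : Bᶜ.Nonempty) : ContinuousOn (edgeFunction A B) (A ∪ B) := by
  refine ContinuousOn.div (Metric.continuous_infDist_pt _).continuousOn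
    ((Metric.continuous_infDist_pt _).add (Metric.continuous_infDist_pt _)).continuousOn ?_
  rintro x (hx | hx)
  · exact (add_pos_of_pos_of_nonneg (infDist_compl_pos hA hA' hx) Metric.infDist_nonneg).ne'
  · exact (add_pos_of_nonneg_of_pos Metric.infDist_nonneg (infDist_compl_pos hB hB' hx)).ne'

/-- Passing to the circle identifies the value `1` on `A \ B` with the value `0` off `A`. -/
theorem coe_edgeFunction_eq_zero (hA : IsOpen A) (hA' : Aᶜ.Nonempty) {x : X}
    (hx : x ∈ A → x ∉ B) : (edgeFunction A B x : AddCircle (1 : ℝ)) = 0 := by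
  by_cases hxA : x ∈ A
  · rw [edgeFunction_eq_one hA hA' hxA (hx hxA)]
    exact AddCircle.coe_period (1 : ℝ)
  · rw [edgeFunction_eq_zero hxA]
    exact AddCircle.coe_zero (p := (1 : ℝ))

variable {𝒲 : Set (Set X)} {R D : ℝ}

/-- On every member of the cover, the edge function agrees modulo `1` with a continuous function. -/
theorem IsPathConnectedCover.exists_continuousOn_coe_eq (h𝒲 : IsPathConnectedCover 𝒲 R D)
    (hX : ¬ AsdimLE X 0) (hA : A ∈ 𝒲) (hB : B ∈ 𝒲) (hAB : A ≠ B) {W : Set X} (hW : W ∈ 𝒲) :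
    ∃ h : X → ℝ, ContinuousOn h W ∧
      ∀ x ∈ W, (h x : AddCircle (1 : ℝ)) = (edgeFunction A B x : AddCircle (1 : ℝ)) := by
  have hA' := exists_notMem_of_not_asdimLE_zero hX (h𝒲.dist_le A hA)
  have hB' := exists_notMem_of_not_asdimLE_zero hX (h𝒲.dist_le B hB)
  have hcont := continuousOn_edgeFunction (h𝒲.isOpen A hA) hA' (h𝒲.isOpen B hB) hB'
  by_cases hWA : W = A
  · exact ⟨_, hcont.mono (hWA ▸ subset_union_left), fun _ _ => rfl⟩
  by_cases hWB : W = B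
  · exact ⟨_, hcont.mono (hWB ▸ subset_union_right), fun _ _ => rfl⟩
  -- A third member misses `A ∩ B` by the multiplicity bound.
  refine ⟨fun _ => 0, continuousOn_const, fun x hxW => ?_⟩
  rw [coe_edgeFunction_eq_zero (h𝒲.isOpen A hA) hA' fun hxA hxB => ?_, AddCircle.coe_zero]
  rcases h𝒲.eq_or_eq A hA B hB W hW x hxA hxB hxW with h | h | h
  exacts [hAB h, hWA h.symm, hWB h.symm]

theorem dist_le_of_pathLength_le {y : X} (f : Path y y) {L : ℝ} (hL : 0 ≤ L)
    (hf : pathLength f ≤ ENNReal.ofReal L) (t : I) : dist (f t) y ≤ L := by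
  have h := (eVariationOn.edist_le f (mem_univ t) (mem_univ (0 : I))).trans hf
  rw [f.source, edist_dist] at h
  exact (ENNReal.ofReal_le_ofReal_iff hL).1 h

/-- A function which is integer-valued and continuous on a preconnected set is constant there. -/
theorem eq_of_coe_addCircle_eq_zero {S : Set X} (hS : IsPreconnected S) {g : X → ℝ}
    (hg : ContinuousOn g S) (hint : ∀ x ∈ S, (g x : AddCircle (1 : ℝ)) = 0) {x y : X} (hx : x ∈ S)
    (hy : y ∈ S) : g x = g y := by
  have hZ : g '' S ⊆ range ((↑) : ℤ → ℝ) := by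
    rintro _ ⟨z, hz, rfl⟩
    obtain ⟨n, hn⟩ := (AddCircle.coe_eq_zero_iff (1 : ℝ)).1 (hint z hz)
    exact ⟨n, by simpa using hn⟩
  exact (countable_range _).isTotallyDisconnected _ hZ (hS.image g hg) ⟨x, hx, rfl⟩ ⟨y, hy, rfl⟩

/-- If loops shorter than the Lebesgue number generate the fundamental group, then every edge of
the nerve is a bridge: its circle-valued map lifts to `ℝ`, and the lift separates the two ends of
the edge. -/
theorem IsPathConnectedCover.nerve_isAcyclic [Nonempty X] (hgeo : IsGeodesicSpace X)
    (hX : ¬ AsdimLE X 0) {L : ℝ} (hL : 0 < L) (hLR : L < R)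
    (hgen : ∀ x₀ : X, Subgroup.closure (shortLoopClasses X x₀ L) = ⊤)
    (h𝒲 : IsPathConnectedCover 𝒲 R D) : (nerve 𝒲).IsAcyclic := by
  have := hgeo.pathConnectedSpace
  have := hgeo.locallyPathConnectedSpace
  rw [SimpleGraph.isAcyclic_iff_forall_adj_isBridge]
  rintro ⟨A, hA⟩ ⟨B, hB⟩ ⟨hne, z, hzA, hzB⟩
  have hAB : A ≠ B := fun h => hne (Subtype.ext h)
  have hAo := h𝒲.isOpen A hA
  have hBo := h𝒲.isOpen B hB
  have hA' := exists_notMem_of_not_asdimLE_zero hX (h𝒲.dist_le A hA)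
  have hB' := exists_notMem_of_not_asdimLE_zero hX (h𝒲.dist_le B hB)
  have hlocal := fun (W : Set X) hW => h𝒲.exists_continuousOn_coe_eq hX hA hB hAB (W := W) hW
  let φ : C(X, AddCircle (1 : ℝ)) := ⟨fun x => (edgeFunction A B x : AddCircle (1 : ℝ)), by
    rw [continuous_iff_continuousAt]
    intro x
    obtain ⟨W, hW⟩ := h𝒲.exists_mem (hL.trans hLR) x
    obtain ⟨h, hh, hφ⟩ := hlocal W.1 W.2
    have hWx : W.1 ∈ 𝓝 x := (h𝒲.isOpen W.1 W.2).mem_nhds hW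
    have h1 : ContinuousAt (fun x => (h x : AddCircle (1 : ℝ))) x :=
      (AddCircle.continuous_mk' (1 : ℝ)).continuousAt.comp (hh.continuousAt hWx)
    exact h1.congr (Filter.eventually_of_mem hWx hφ)⟩
  obtain ⟨g, hg⟩ := exists_real_lift φ (hgen z) fun y f hf => by
    obtain ⟨W, hW, hsub⟩ := h𝒲.exists_ball_subset y
    obtain ⟨h, hh, hφ⟩ := hlocal W hW
    have hfW : ∀ t, f t ∈ W := fun t =>
      hsub ((dist_le_of_pathLength_le f hL.le hf t).trans_lt hLR)
    exact ⟨⟨fun t => h (f t), hh.comp_continuous f.continuous hfW⟩, by simp,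
      fun t => hφ _ (hfW t)⟩
  -- On `A ∪ B` the edge function is itself a continuous real lift, so it differs from `g` by a
  -- locally constant integer.
  have hconst : ∀ S ⊆ A ∪ B, IsPreconnected S → ∀ x ∈ S, ∀ y ∈ S,
      g x - edgeFunction A B x = g y - edgeFunction A B y := by
    intro S hS hpre x hx y hy
    refine eq_of_coe_addCircle_eq_zero (g := fun x => g x - edgeFunction A B x) hpre
      (g.continuous.continuousOn.sub ((continuousOn_edgeFunction hAo hA' hBo hB').mono hS))
      (fun w _ => ?_) hx hy
    rw [AddCircle.coe_sub, hg w]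
    exact sub_self _
  have hpath := fun (W : Set X) hW => (h𝒲.isPathConnected W hW).isConnected.isPreconnected
  -- Here `r` is the value of `g` on `W` off `A ∩ B`. For `A` and `B` it is prescribed through `z ∈
  -- A ∩ B`, so that it makes sense even if `A \ B` or `B \ A` is empty.
  have hvalue : ∀ W : 𝒲, ∃ r : ℝ, (W.1 = A → r = g z - edgeFunction A B z + 1) ∧
      (W.1 = B → r = g z - edgeFunction A B z) ∧ ∀ x ∈ W.1, ¬ (x ∈ A ∧ x ∈ B) → g x = r := by
    rintro ⟨W, hW⟩
    by_cases hWA : W = A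
    · subst hWA
      refine ⟨_, fun _ => rfl, fun h => absurd h hAB, fun x hx hxB => ?_⟩
      have := hconst W subset_union_left (hpath W hW) x hx z hzA
      rw [edgeFunction_eq_one hAo hA' hx fun h => hxB ⟨hx, h⟩] at this
      linarith
    by_cases hWB : W = B
    · subst hWB
      refine ⟨_, fun h => absurd h hWA, fun _ => rfl, fun x hx hxA => ?_⟩
      have := hconst W subset_union_right (hpath W hW) x hx z hzB
      rw [edgeFunction_eq_zero fun h => hxA ⟨h, hx⟩] at this
      linarith
    · obtain ⟨w, hw⟩ := (h𝒲.isPathConnected W hW).nonempty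
      refine ⟨g w, fun h => absurd h hWA, fun h => absurd h hWB, fun x hx _ => ?_⟩
      refine eq_of_coe_addCircle_eq_zero (hpath W hW) g.continuous.continuousOn
        (fun v hv => ?_) hx hw
      rw [hg v]
      refine coe_edgeFunction_eq_zero hAo hA' fun hvA hvB => ?_
      rcases h𝒲.eq_or_eq A hA B hB W hW v hvA hvB hv with h | h | h
      exacts [hAB h, hWA h.symm, hWB h.symm]
  choose r hrA hrB hr using hvalue
  have hadj : ∀ W W' : 𝒲, ((nerve 𝒲).deleteEdges {s(⟨A, hA⟩, ⟨B, hB⟩)}).Adj W W' → r W = r W' := by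
    intro W W' hWW'
    rw [SimpleGraph.deleteEdges_adj] at hWW'
    obtain ⟨⟨hne', x, hxW, hxW'⟩, hedge⟩ := hWW'
    -- Were `x` in `A ∩ B`, multiplicity two would force `W` and `W'` to be `A` and `B`, the ends of
    -- the deleted edge.
    have hx : ¬ (x ∈ A ∧ x ∈ B) := by
      rintro ⟨hxA, hxB⟩
      have h1 := h𝒲.eq_or_eq A hA B hB W.1 W.2 x hxA hxB hxW
      have h2 := h𝒲.eq_or_eq A hA B hB W'.1 W'.2 x hxA hxB hxW'
      refine hedge ?_
      rw [mem_singleton_iff, Sym2.eq_iff]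
      have hne'' : W.1 ≠ W'.1 := fun h => hne' (Subtype.ext h)
      simp only [Subtype.ext_iff]
      grind
    rw [← hr W x hxW hx, ← hr W' x hxW' hx]
  rw [SimpleGraph.isBridge_iff]
  rintro ⟨w⟩
  have hw : ∀ {W W' : 𝒲}, ((nerve 𝒲).deleteEdges {s(⟨A, hA⟩, ⟨B, hB⟩)}).Walk W W' →
      r W = r W' := by
    intro W W' w
    induction w with
    | nil => rfl
    | cons h _ ih => exact (hadj _ _ h).trans ih
  have := hw w
  rw [hrA _ rfl, hrB _ rfl] at this
  linarith

end Edge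

end CoarseTree

theorem mainTheorem7 (X : Type u) [MetricSpace X]
    (hgeo : CoarseTree.IsGeodesicSpace X)
    (hdim : CoarseTree.AsdimEq X 1)
    (hgen : CoarseTree.UniformlyGeneratedPi1 X) :
    ∃ (V : Type u) (T : SimpleGraph V) (hT : T.IsTree), Infinite V ∧
      CoarseTree.QuasiIsometric X (CoarseTree.Realization T hT.connected) := by
  have hX : ¬ CoarseTree.AsdimLE X 0 := hdim.2
  have : Nonempty X := by
    by_contra h
    rw [not_nonempty_iff] at h
    exact hX (CoarseTree.asdimLE_zero_of_dist_le (D := 0) fun x => h.elim x)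
  obtain ⟨L, hL, hgen⟩ := hgen
  -- Any scale larger than `L` would do.
  have hR : 0 < L + 1 := by positivity
  obtain ⟨𝒲, D, h𝒲⟩ := hdim.1.exists_isPathConnectedCover hgeo hR
  exact ⟨𝒲, CoarseTree.nerve 𝒲,
    ⟨h𝒲.nerve_connected hgeo hR, h𝒲.nerve_isAcyclic hgeo hX hL (lt_add_one L) hgen⟩,
    h𝒲.infinite hR hX, h𝒲.quasiIsometric hgeo hR _⟩
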